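/- Let $1<q<2$, let $p$ be the conjugate exponent, $\frac1p+\frac1q=1$, and let $d\in\mathbb N$. Let $L_r(\mathbb R^d)$ denote the Lebesgue space of real-valued or of complex-valued functions (the statement holds in both cases), let $(T_\lambda f)(x)=f(x-\lambda)$ for $\lambda,x\in\mathbb R^d$, and identify the dual space $L_q^*(\mathbb R^d)$ with $L_p(\mathbb R^d)$, where $f\in L_p(\mathbb R^d)$ acts on $L_q(\mathbb R^d)$ as the functional $h\mapsto\int_{\mathbb R^d} f(x)h(x)\,dx$. If $(\lambda_n)_{n\in\mathbb N}\subset\mathbb R^d$ is an unbounded sequence, then there exist a function $f^*\in L_q^*(\mathbb R^d)=L_p(\mathbb R^d)$ and a sequence $(g_n)_{n\in\mathbb N}\subset L_q(\mathbb R^d)$ such that $(g_n,T_{\lambda_n}f^*)_{n\in\mathbb N}$ is a Schauder frame for $L_q(\mathbb R^d)$, that is, for every $h\in L_q(\mathbb R^d)$, $$h=\sum_{n=1}^\infty (T_{\lambda_n}f^*)(h)\,g_n=\sum_{n=1}^\infty\Big(\int_{\mathbb R^d} f^*(x-\lambda_n)h(x)\,dx\Big)g_n ,$$ where the series converges in the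 norm of $L_q(\mathbb R^d)$. -/

import Mathlib

open MeasureTheory Filter Topology
open scoped ENNReal

noncomputable section

/-- A sequence of pairs `(x i, φ i)` in `X × X*` is a Schauder frame for `X` if, for every `v`,
the series `∑ φ i v • x i` converges to `v` in norm (as a limit of its partial sums, in the
given order). -/
def IsSchauderFrame {𝕜 X : Type*} [RCLike 𝕜] [NormedAddCommGroup X] [NormedSpace 𝕜 X]
    (x : ℕ → X) (φ : ℕ → StrongDual 𝕜 X) : Prop :=
  ∀ v : X, Tendsto (fun N : ℕ => ∑ i ∈ Finset.range N, φ i v • x i) atTop (𝓝 v)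

/-- The translation operator on `L_p(ℝ^d)`: `(T_a f)(x) = f (x - a)`. -/
def translateLp {𝕜 : Type*} [RCLike 𝕜] {d : ℕ} {p : ℝ≥0∞}
    (a : EuclideanSpace ℝ (Fin d)) (f : Lp 𝕜 p (volume : Measure (EuclideanSpace ℝ (Fin d)))) :
    Lp 𝕜 p (volume : Measure (EuclideanSpace ℝ (Fin d))) :=
  Lp.compMeasurePreserving (fun x => x - a) (measurePreserving_sub_right volume a) f

/-- For conjugate exponents `p`, `q`, the bounded linear functional `h ↦ ∫ f h` on `L_q(ℝ^d)`
given by a function `f` in `L_p(ℝ^d)`. For `1 < q < ∞` this is the usual identification of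
`L_p(ℝ^d)` with the dual space `L_q(ℝ^d)*`. -/
def dualFunctional {𝕜 : Type*} [RCLike 𝕜] {d : ℕ} {p q : ℝ≥0∞} [Fact (1 ≤ p)] [Fact (1 ≤ q)]
    [p.HolderConjugate q] (f : Lp 𝕜 p (volume : Measure (EuclideanSpace ℝ (Fin d)))) :
    StrongDual 𝕜 (Lp 𝕜 q (volume : Measure (EuclideanSpace ℝ (Fin d)))) :=
  (ContinuousLinearMap.mul 𝕜 𝕜).lpPairing volume p q f

end

/-!
The space `L_q` has a Schauder frame `(x j, φ j)` in which `φ j` integrates over a set `Q j` of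
diameter at most `1`: averaging over the atoms generated by finitely many such sets is a contraction
of finite rank, these operators converge strongly to the identity, and splitting their differences
into rank one terms, repeated often with small weights, gives a frame
(`exists_isSchauderFrame_indicatorFunctional`, `exists_isSchauderFrame_of_finiteRank`).

To replace the `φ j` by translates of one function, `φ j` is repeated `N j` times with coefficient
`N j ^ (-1 / 2)`. Enumerating all repetitions by `n`, with sets `Q n` and coefficients `c n`, and
choosing a fast growing subsequence `μ n` of the translations, let `f = ∑ n, c n • 1_{Q n - μ n}`.
The summands are disjointly supported, so `‖f‖ ^ p = ∑ n, c n ^ p * |Q n|`. Block `j` contributes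
`N j ^ (1 - p / 2) * |Q j|`, which is small for large `N j` because `p > 2`.

Translating `f` by `μ n` gives `c n • 1_{Q n}` plus a remainder. Since the sets `Q n` have diameter at
most `1` and `μ` is sparse, the remainders for different `n` are again disjointly supported, so the
sum of the remainders of block `j` has norm at most `N j ^ (1 / p) * ‖f‖`
(`exists_translates_close`). After rescaling by `N j ^ (-1 / 2)` this is small, again because `p > 2`.
Thus the translates of `f` with suitably repeated vectors `x j` represent an operator close to the
identity, and applying its inverse to the vectors yields a frame
(`IsSchauderFrame.exists_of_block_perturbation`). Translations outside the subsequence receive the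
zero vector.
-/

/-! ### Series split into consecutive blocks -/

section Blocks

lemma exists_block {off : ℕ → ℕ} (hoff : StrictMono off) {n : ℕ} (hn : off 0 ≤ n) :
    ∃ j, off j ≤ n ∧ n < off (j + 1) := by
  induction n with
  | zero => exact ⟨0, hn, (Nat.zero_le _).trans_lt (hoff (Nat.lt_succ_self 0))⟩
  | succ n ih =>
    rcases hn.eq_or_lt with h | h
    · exact ⟨0, hn, h ▸ hoff (Nat.lt_succ_self 0)⟩
    · obtain ⟨j, h1, h2⟩ := ih (Nat.lt_succ_iff.1 h)
      rcases (Nat.succ_le_of_lt h2).eq_or_lt with h3 | h3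
      · exact ⟨j + 1, h3.ge, h3.trans_lt (hoff (Nat.lt_succ_self _))⟩
      · exact ⟨j, h1.trans (Nat.le_succ n), h3⟩

/-- A sequence converges as soon as it converges along block endpoints and its oscillation inside
the blocks tends to zero. -/
lemma tendsto_of_tendsto_blocks {X : Type*} [NormedAddCommGroup X] {S : ℕ → X} {s : X}
    {off : ℕ → ℕ} (hoff : StrictMono off) (hS : Tendsto (fun j => S (off j)) atTop (𝓝 s))
    {b : ℕ → ℝ} (hb : Tendsto b atTop (𝓝 0))
    (h : ∀ j n, off j ≤ n → n < off (j + 1) → ‖S n - S (off j)‖ ≤ b j) :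
    Tendsto S atTop (𝓝 s) := by
  rw [Metric.tendsto_atTop]
  intro ε hε
  obtain ⟨J₁, hJ₁⟩ := Metric.tendsto_atTop.1 hS (ε / 2) (half_pos hε)
  obtain ⟨J₂, hJ₂⟩ := Metric.tendsto_atTop.1 hb (ε / 2) (half_pos hε)
  refine ⟨off (max J₁ J₂), fun n hn => ?_⟩
  obtain ⟨j, h1, h2⟩ := exists_block hoff ((hoff.monotone (Nat.zero_le _)).trans hn)
  have hj : max J₁ J₂ ≤ j := Nat.lt_succ_iff.1 (hoff.lt_iff_lt.1 (hn.trans_lt h2))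
  have h3 := hJ₁ j ((le_max_left _ _).trans hj)
  have h4 := hJ₂ j ((le_max_right _ _).trans hj)
  rw [Real.dist_eq, sub_zero] at h4
  have h5 := (h j n h1 h2).trans_lt ((le_abs_self _).trans_lt h4)
  rw [← dist_eq_norm] at h5
  linarith [dist_triangle (S n) (S (off j)) s]

lemma strictMono_sum_range {L : ℕ → ℕ} (hL : ∀ j, 0 < L j) :
    StrictMono fun j => ∑ i ∈ Finset.range j, L i :=
  strictMono_nat_of_lt_succ fun j => by rw [Finset.sum_range_succ]; have := hL j; omega

lemma exists_eq_sum_range_add {L : ℕ → ℕ} (hL : ∀ j, 0 < L j) (n : ℕ) :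
    ∃ j a, a < L j ∧ n = ∑ i ∈ Finset.range j, L i + a := by
  obtain ⟨j, h1, h2⟩ := exists_block (strictMono_sum_range hL) (n := n) (by simp)
  rw [Finset.sum_range_succ] at h2
  exact ⟨j, n - ∑ i ∈ Finset.range j, L i, by omega, by omega⟩

lemma eq_of_sum_range_add_eq {L : ℕ → ℕ} (hL : ∀ j, 0 < L j) {j j' a a' : ℕ} (ha : a < L j)
    (ha' : a' < L j')
    (h : ∑ i ∈ Finset.range j, L i + a = ∑ i ∈ Finset.range j', L i + a') : j = j' ∧ a = a' := by
  have hm := strictMono_sum_range hL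
  have key : j = j' := by
    by_contra hne
    rcases lt_or_gt_of_ne hne with hlt | hlt
    · have h1 := hm.monotone (Nat.succ_le_of_lt hlt)
      simp only [Nat.succ_eq_add_one, Finset.sum_range_succ] at h1
      omega
    · have h1 := hm.monotone (Nat.succ_le_of_lt hlt)
      simp only [Nat.succ_eq_add_one, Finset.sum_range_succ] at h1
      omega
  subst key
  exact ⟨rfl, by omega⟩

/-- Concatenation of the finite words `w j 0, …, w j (L j - 1)` into one sequence. -/
lemma exists_concat {α : Type*} {L : ℕ → ℕ} (hL : ∀ j, 0 < L j) (w : ℕ → ℕ → α) :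
    ∃ s : ℕ → α, ∀ j a, a < L j → s (∑ i ∈ Finset.range j, L i + a) = w j a := by
  choose jj aa h1 h2 using exists_eq_sum_range_add hL
  refine ⟨fun n => w (jj n) (aa n), fun j a ha => ?_⟩
  obtain ⟨h3, h4⟩ := eq_of_sum_range_add_eq hL ha (h1 _) (h2 (∑ i ∈ Finset.range j, L i + a))
  simp only [← h3, ← h4]

lemma sum_range_sum_range {M : Type*} [AddCommMonoid M] (L : ℕ → ℕ) (s : ℕ → M) (J : ℕ) :
    ∑ n ∈ Finset.range (∑ i ∈ Finset.range J, L i), s n =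
      ∑ j ∈ Finset.range J, ∑ a ∈ Finset.range (L j), s (∑ i ∈ Finset.range j, L i + a) := by
  induction J with
  | zero => simp
  | succ J ih => rw [Finset.sum_range_succ, Finset.sum_range_add, ih, Finset.sum_range_succ]

lemma tendsto_sum_range_of_blocks {X : Type*} [NormedAddCommGroup X] {w : ℕ → X} {s : X}
    {L : ℕ → ℕ} (hL : ∀ j, 0 < L j)
    (hS : Tendsto (fun J => ∑ j ∈ Finset.range J, ∑ a ∈ Finset.range (L j),
      w (∑ i ∈ Finset.range j, L i + a)) atTop (𝓝 s))
    {b : ℕ → ℝ} (hb : Tendsto b atTop (𝓝 0))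
    (h : ∀ j A, A < L j →
      ‖∑ a ∈ Finset.range A, w (∑ i ∈ Finset.range j, L i + a)‖ ≤ b j) :
    Tendsto (fun N => ∑ n ∈ Finset.range N, w n) atTop (𝓝 s) := by
  refine tendsto_of_tendsto_blocks (strictMono_sum_range hL) ?_ hb ?_
  · simpa only [sum_range_sum_range] using hS
  · intro j n h1 h2
    obtain ⟨A, rfl⟩ := Nat.exists_eq_add_of_le h1
    rw [Finset.sum_range_add, add_sub_cancel_left]
    refine h j A ?_
    rw [Finset.sum_range_succ] at h2
    omega

lemma sum_range_mod {M : Type*} [AddCommMonoid M] (u : ℕ → M) (r m : ℕ) :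
    ∑ a ∈ Finset.range (r * m), u (a % r) = m • ∑ t ∈ Finset.range r, u t := by
  induction m with
  | zero => simp
  | succ m ih =>
    rw [Nat.mul_succ, Finset.sum_range_add, ih, succ_nsmul]
    congr 1
    refine Finset.sum_congr rfl fun t ht => ?_
    rw [Nat.mul_add_mod, Nat.mod_eq_of_lt (Finset.mem_range.1 ht)]

end Blocks

/-! ### Constructions of Schauder frames in Banach spaces -/

section Frames

variable {𝕜 X : Type*} [RCLike 𝕜] [NormedAddCommGroup X] [NormedSpace 𝕜 X]

lemma tendsto_of_tendsto_sum_range {s : X} {u : ℕ → X}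
    (h : Tendsto (fun N => ∑ i ∈ Finset.range N, u i) atTop (𝓝 s)) :
    Tendsto u atTop (𝓝 0) := by
  have h1 := ((tendsto_add_atTop_iff_nat 1).2 h).sub h
  simpa [Finset.sum_range_succ] using h1

/-- A Schauder frame with functionals along a subsequence extends by zero vectors to one with the
full sequence of functionals. -/
lemma IsSchauderFrame.of_subsequence {ψ : ℕ → StrongDual 𝕜 X} {k : ℕ → ℕ} (hk : StrictMono k)
    {g : ℕ → X} (hg : IsSchauderFrame g fun n => ψ (k n)) : ∃ g', IsSchauderFrame g' ψ := by
  refine ⟨Function.extend k g 0, fun v => ?_⟩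
  have hext : ∀ n, Function.extend k g 0 (k n) = g n := fun n => hk.injective.extend_apply g 0 n
  set w : ℕ → X := fun i => ψ i v • Function.extend k g 0 i with hw
  have hw0 : ∀ i, i ∉ Set.range k → w i = 0 := fun i hi => by
    simp only [hw]
    rw [Function.extend_apply' _ _ _ (fun ⟨a, ha⟩ => hi ⟨a, ha⟩)]
    simp
  have hwk : ∀ n, w (k n) = ψ (k n) v • g n := fun n => by simp only [hw, hext]
  -- Between `k J` and `k (J + 1)` the partial sums of `w` only pick up the term at `k J`.
  have hgap : ∀ J m, k J < m → m ≤ k (J + 1) →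
      ∑ i ∈ Finset.range m, w i = ∑ i ∈ Finset.range (k J), w i + w (k J) := by
    intro J m h1
    induction m, h1 using Nat.le_induction with
    | base => intro _; rw [Nat.succ_eq_add_one, Finset.sum_range_succ]
    | succ m hm ih =>
      intro h2
      rw [Finset.sum_range_succ, ih (by omega), hw0 m, add_zero]
      rintro ⟨n, rfl⟩
      have h3 := hk.lt_iff_lt.1 (Nat.lt_of_succ_le hm)
      have h4 := hk.lt_iff_lt.1 (Nat.lt_of_succ_le h2)
      omega
  have h0 : ∀ m, m ≤ k 0 → ∑ i ∈ Finset.range m, w i = 0 := fun m hm =>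
    Finset.sum_eq_zero fun i hi => hw0 i (by
      rintro ⟨n, rfl⟩
      have := hk.monotone (Nat.zero_le n)
      have := Finset.mem_range.1 hi
      omega)
  have hsum : ∀ J, ∑ i ∈ Finset.range (k J), w i = ∑ n ∈ Finset.range J, ψ (k n) v • g n := by
    intro J
    induction J with
    | zero => simp [h0]
    | succ J ih => rw [hgap J _ (hk (Nat.lt_succ_self J)) le_rfl, ih, Finset.sum_range_succ, hwk]
  have hv := hg v
  refine tendsto_of_tendsto_blocks hk (by simpa only [hsum] using hv)
    (b := fun J => ‖w (k J)‖) ?_ ?_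
  · simpa only [hwk] using tendsto_zero_iff_norm_tendsto_zero.1 (tendsto_of_tendsto_sum_range hv)
  · intro J n h1 h2
    rcases h1.eq_or_lt with rfl | h1
    · simp
    · rw [hgap J n h1 h2.le, add_sub_cancel_left]

lemma exists_eq_sum_of_mem_span_smulRight {Φ : Set (StrongDual 𝕜 X)} (hΦ : Φ.Nonempty)
    {T : X →L[𝕜] X}
    (hT : T ∈ Submodule.span 𝕜 {T : X →L[𝕜] X | ∃ φ ∈ Φ, ∃ x, T = φ.smulRight x}) :
    ∃ r, 0 < r ∧ ∃ (φ : ℕ → Φ) (x : ℕ → X),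
      ∀ v, T v = ∑ t ∈ Finset.range r, (φ t : StrongDual 𝕜 X) v • x t := by
  obtain ⟨φ₀, hφ₀⟩ := hΦ
  induction hT using Submodule.span_induction with
  | mem T hT =>
    obtain ⟨φ, hφ, x, rfl⟩ := hT
    exact ⟨1, one_pos, fun _ => ⟨φ, hφ⟩, fun _ => x, fun v => by simp⟩
  | zero => exact ⟨1, one_pos, fun _ => ⟨φ₀, hφ₀⟩, fun _ => 0, fun v => by simp⟩
  | add S T _ _ hS hT =>
    obtain ⟨r, hr, φ, x, h⟩ := hS
    obtain ⟨r', hr', φ', x', h'⟩ := hT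
    refine ⟨r + r', by omega, fun t => if t < r then φ t else φ' (t - r),
      fun t => if t < r then x t else x' (t - r), fun v => ?_⟩
    rw [Finset.sum_range_add, add_apply, h, h']
    congr 1
    · refine Finset.sum_congr rfl fun t ht => ?_
      simp [Finset.mem_range.1 ht]
    · simp
  | smul c T _ hT =>
    obtain ⟨r, hr, φ, x, h⟩ := hT
    refine ⟨r, hr, φ, fun t => c • x t, fun v => ?_⟩
    rw [smul_apply, h, Finset.smul_sum]
    exact Finset.sum_congr rfl fun t _ => smul_comm _ _ _

/-- If finite rank operators built from functionals in `Φ` converge strongly to the identity, then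
there is a Schauder frame with functionals in `Φ`. Each difference of consecutive operators is
written as a sum of rank one operators, which is then traversed `N` times with weight `1 / N`; this
makes the intermediate partial sums harmless. -/
theorem exists_isSchauderFrame_of_finiteRank {Φ : Set (StrongDual 𝕜 X)} (hΦ : Φ.Nonempty)
    {P : ℕ → X →L[𝕜] X}
    (hP : ∀ m, P m ∈ Submodule.span 𝕜 {T : X →L[𝕜] X | ∃ φ ∈ Φ, ∃ x, T = φ.smulRight x})
    (hlim : ∀ v, Tendsto (fun m => P m v) atTop (𝓝 v)) :
    ∃ (x : ℕ → X) (φ : ℕ → StrongDual 𝕜 X), (∀ n, φ n ∈ Φ) ∧ IsSchauderFrame x φ := by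
  -- `D 0 = P 0` and `D (j + 1) = P (j + 1) - P j`.
  let D : ℕ → X →L[𝕜] X := fun j => P j - if j = 0 then 0 else P (j - 1)
  have hD : ∀ j, D j ∈ Submodule.span 𝕜 {T : X →L[𝕜] X | ∃ φ ∈ Φ, ∃ x, T = φ.smulRight x} := by
    intro j
    refine Submodule.sub_mem _ (hP j) ?_
    split_ifs
    · exact Submodule.zero_mem _
    · exact hP _
  have hDsum : ∀ v, Tendsto (fun J => ∑ j ∈ Finset.range J, D j v) atTop (𝓝 v) := by
    intro v
    rw [← tendsto_add_atTop_iff_nat 1]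
    refine (hlim v).congr fun J => ?_
    induction J with
    | zero => simp [D]
    | succ J ih => rw [Finset.sum_range_succ, ← ih]; simp [D]
  choose r hr φ x hφx using fun j => exists_eq_sum_of_mem_span_smulRight hΦ (hD j)
  let C : ℕ → ℝ := fun j => ∑ t ∈ Finset.range (r j), ‖(φ j t : StrongDual 𝕜 X)‖ * ‖x j t‖
  choose N hN using fun j => exists_nat_gt ((2 : ℝ) ^ j * C j)
  have hC : ∀ j, 0 ≤ C j := fun j => Finset.sum_nonneg fun t _ => by positivity
  have hN0 : ∀ j, 0 < N j := fun j => by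
    have : (0 : ℝ) < N j := (mul_nonneg (by positivity) (hC j)).trans_lt (hN j)
    exact_mod_cast this
  -- An incomplete traversal of the rank one terms costs at most `C j / N j`.
  have hCN : ∀ j, C j / N j ≤ (1 / 2) ^ j := fun j => by
    have : (0 : ℝ) < N j := by exact_mod_cast hN0 j
    rw [div_le_iff₀ this, one_div, inv_pow, ← div_eq_inv_mul, le_div_iff₀ (by positivity)]
    linarith [hN j]
  have hL : ∀ j, 0 < r j * N j := fun j => Nat.mul_pos (hr j) (hN0 j)
  obtain ⟨s, hs⟩ := exists_concat hL
    (fun j a => (((N j : 𝕜)⁻¹ • x j (a % r j), φ j (a % r j)) : X × Φ))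
  refine ⟨fun n => (s n).1, fun n => (s n).2, fun n => (s n).2.2, fun v => ?_⟩
  have hpart : ∀ j A, A ≤ r j * N j →
      ∑ a ∈ Finset.range A, ((s (∑ i ∈ Finset.range j, r i * N i + a)).2 : StrongDual 𝕜 X) v •
        (s (∑ i ∈ Finset.range j, r i * N i + a)).1 =
      ∑ a ∈ Finset.range A, (N j : 𝕜)⁻¹ •
        ((φ j (a % r j) : StrongDual 𝕜 X) v • x j (a % r j)) := by
    intro j A hA
    refine Finset.sum_congr rfl fun a ha => ?_
    rw [hs j a ((Finset.mem_range.1 ha).trans_le hA)]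
    exact smul_comm _ _ _
  refine tendsto_sum_range_of_blocks hL (b := fun j => ‖D j v‖ + (1 / 2) ^ j * ‖v‖) ?_ ?_ ?_
  · refine (hDsum v).congr fun J => Finset.sum_congr rfl fun j _ => ?_
    have : (N j : 𝕜) ≠ 0 := by exact_mod_cast (hN0 j).ne'
    rw [hpart j _ le_rfl, ← Finset.smul_sum,
      sum_range_mod (fun t => (φ j t : StrongDual 𝕜 X) v • x j t), ← hφx,
      ← Nat.cast_smul_eq_nsmul 𝕜, smul_smul, inv_mul_cancel₀ this, one_smul]
  · have h1 := (tendsto_zero_iff_norm_tendsto_zero.1 (tendsto_of_tendsto_sum_range (hDsum v))).add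
      ((tendsto_pow_atTop_nhds_zero_of_lt_one (r := (1 / 2 : ℝ)) (by norm_num)
        (by norm_num)).mul_const ‖v‖)
    simpa using h1
  · intro j A hA
    have hNj : (0 : ℝ) < N j := by exact_mod_cast hN0 j
    rw [hpart j A hA.le, ← Finset.smul_sum]
    have hmN : A / r j ≤ N j := (Nat.div_le_iff_le_mul_add_pred (hr j)).2 (by omega)
    have hb : A % r j ≤ r j := (Nat.mod_lt _ (hr j)).le
    rw [← Nat.div_add_mod A (r j), Finset.sum_range_add,
      sum_range_mod (fun t => (φ j t : StrongDual 𝕜 X) v • x j t), ← hφx, smul_add]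
    refine (norm_add_le _ _).trans (add_le_add ?_ ?_)
    · rw [← Nat.cast_smul_eq_nsmul 𝕜, smul_smul, norm_smul, norm_mul, norm_inv, RCLike.norm_natCast,
        RCLike.norm_natCast]
      refine mul_le_of_le_one_left (norm_nonneg _) ?_
      rw [inv_mul_le_iff₀ hNj, mul_one]
      exact_mod_cast hmN
    · rw [norm_smul, norm_inv, RCLike.norm_natCast]
      calc (N j : ℝ)⁻¹ * _ ≤ (N j : ℝ)⁻¹ * (C j * ‖v‖) := by
            refine mul_le_mul_of_nonneg_left ?_ (by positivity)
            refine (norm_sum_le _ _).trans ?_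
            rw [Finset.sum_mul]
            refine (Finset.sum_le_sum (g := fun t =>
              ‖(φ j t : StrongDual 𝕜 X)‖ * ‖x j t‖ * ‖v‖) fun t ht => ?_).trans
              (Finset.sum_le_sum_of_subset_of_nonneg (Finset.range_mono hb)
                fun _ _ _ => by positivity)
            have ht' := (Finset.mem_range.1 ht).trans_le hb
            rw [Nat.mul_add_mod, Nat.mod_eq_of_lt ht', norm_smul, mul_right_comm]
            exact mul_le_mul_of_nonneg_right (ContinuousLinearMap.le_opNorm _ _) (norm_nonneg _)
        _ = C j / N j * ‖v‖ := by ring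
        _ ≤ _ := mul_le_mul_of_nonneg_right (hCN j) (norm_nonneg _)

/-- Perturbation principle: replace each functional `φ j` of a Schauder frame by a block of `N j`
functionals `ψ n`, each close to `c j • φ j` in an averaged sense. The resulting series represents
`1 + E` with `‖E‖ < 1`, and applying the inverse of this operator to the vectors gives a frame. -/
theorem IsSchauderFrame.exists_of_block_perturbation [CompleteSpace X] {x : ℕ → X}
    {φ : ℕ → StrongDual 𝕜 X} (hf : IsSchauderFrame x φ) {N : ℕ → ℕ} (hN : ∀ j, 0 < N j)
    {c : ℕ → 𝕜} (hc : ∀ j, c j ≠ 0) {ψ : ℕ → StrongDual 𝕜 X}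
    (hψ : ∀ j A, A ≤ N j →
      ‖∑ a ∈ Finset.range A, (ψ (∑ i ∈ Finset.range j, N i + a) - c j • φ j)‖ * ‖x j‖ ≤
        N j * ‖c j‖ * (1 / 4 * (1 / 2) ^ j)) :
    ∃ g, IsSchauderFrame g ψ := by
  have hNc : ∀ j, (N j : 𝕜) * c j ≠ 0 := fun j =>
    mul_ne_zero (by exact_mod_cast (hN j).ne') (hc j)
  let R : ℕ → ℕ → StrongDual 𝕜 X := fun j A =>
    ∑ a ∈ Finset.range A, (ψ (∑ i ∈ Finset.range j, N i + a) - c j • φ j)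
  -- The error made by the first `A` terms of block `j` when its vectors are `(N j * c j)⁻¹ • x j`.
  let E : ℕ → ℕ → X →L[𝕜] X := fun j A => ((N j : 𝕜) * c j)⁻¹ • (R j A).smulRight (x j)
  have hE : ∀ j A, A ≤ N j → ‖E j A‖ ≤ 1 / 4 * (1 / 2) ^ j := by
    intro j A hA
    have hpos : 0 < (N j : ℝ) * ‖c j‖ := by
      have := norm_pos_iff.2 (hNc j)
      rwa [norm_mul, RCLike.norm_natCast] at this
    simp only [E, norm_smul, norm_inv, norm_mul, RCLike.norm_natCast,
      ContinuousLinearMap.norm_smulRight_apply]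
    rw [inv_mul_le_iff₀ hpos]
    exact hψ j A hA
  have hgeo : HasSum (fun j : ℕ => (1 / 4 : ℝ) * (1 / 2) ^ j) (1 / 2) := by
    have := hasSum_geometric_two.mul_left (1 / 4 : ℝ)
    norm_num at this ⊢
    exact this
  have hEs : Summable fun j => E j (N j) :=
    Summable.of_norm_bounded hgeo.summable fun j => hE j _ le_rfl
  have hEn : ‖∑' j, E j (N j)‖ < 1 :=
    (tsum_of_norm_bounded hgeo fun j => hE j _ le_rfl).trans_lt (by norm_num)
  have hu : IsUnit (1 + ∑' j, E j (N j)) := by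
    have := (Units.oneSub (-∑' j, E j (N j)) (by rwa [norm_neg])).isUnit
    simpa using this
  obtain ⟨V, hV⟩ := hu.exists_left_inv
  obtain ⟨s, hs⟩ := exists_concat hN (fun j _ => ((N j : 𝕜) * c j)⁻¹ • x j)
  refine ⟨fun n => V (s n), fun v => ?_⟩
  have hpart : ∀ j A, A ≤ N j →
      ∑ a ∈ Finset.range A, ψ (∑ i ∈ Finset.range j, N i + a) v •
        s (∑ i ∈ Finset.range j, N i + a) = ((A : 𝕜) / N j) • (φ j v • x j) + E j A v := by
    intro j A hA
    have h1 : ∀ a ∈ Finset.range A, ψ (∑ i ∈ Finset.range j, N i + a) v •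
        s (∑ i ∈ Finset.range j, N i + a) =
        (N j : 𝕜)⁻¹ • (φ j v • x j) + ((ψ (∑ i ∈ Finset.range j, N i + a) - c j • φ j) v) •
          (((N j : 𝕜) * c j)⁻¹ • x j) := by
      intro a ha
      rw [hs j a ((Finset.mem_range.1 ha).trans_le hA), sub_apply, sub_smul,
        smul_apply, smul_smul (c j • φ j v), smul_eq_mul, smul_smul]
      have h2 : c j * φ j v * ((N j : 𝕜) * c j)⁻¹ = (N j : 𝕜)⁻¹ * φ j v := by
        have := hc j
        rw [mul_inv]
        field_simp
      rw [h2, smul_smul (N j : 𝕜)⁻¹]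
      abel
    rw [Finset.sum_congr rfl h1, Finset.sum_add_distrib, Finset.sum_const, Finset.card_range,
      ← Finset.sum_smul, ← Nat.cast_smul_eq_nsmul 𝕜, smul_smul, ← div_eq_mul_inv]
    simp only [E, R, smul_apply, ContinuousLinearMap.smulRight_apply,
      sum_apply]
    rw [smul_comm (∑ a ∈ Finset.range A, _)]
  have hmain : Tendsto (fun n => ∑ i ∈ Finset.range n, ψ i v • s i) atTop
      (𝓝 ((1 + ∑' j, E j (N j)) v)) := by
    refine tendsto_sum_range_of_blocks hN
      (b := fun j => ‖φ j v • x j‖ + 1 / 4 * (1 / 2) ^ j * ‖v‖) ?_ ?_ ?_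
    · have h1 : Tendsto (fun J => ∑ j ∈ Finset.range J, E j (N j) v) atTop
          (𝓝 ((∑' j, E j (N j)) v)) :=
        ((ContinuousLinearMap.apply 𝕜 X v).hasSum hEs.hasSum).tendsto_sum_nat
      refine ((hf v).add h1).congr fun J => ?_
      rw [← Finset.sum_add_distrib]
      refine Finset.sum_congr rfl fun j _ => ?_
      have : (N j : 𝕜) ≠ 0 := by exact_mod_cast (hN j).ne'
      rw [hpart j _ le_rfl, div_self this, one_smul]
    · have h1 := (tendsto_zero_iff_norm_tendsto_zero.1 (tendsto_of_tendsto_sum_range (hf v))).add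
        (hgeo.summable.tendsto_atTop_zero.mul_const ‖v‖)
      simpa using h1
    · intro j A hA
      rw [hpart j A hA.le]
      refine (norm_add_le _ _).trans (add_le_add ?_ ?_)
      · rw [norm_smul, norm_div, RCLike.norm_natCast, RCLike.norm_natCast]
        refine mul_le_of_le_one_left (norm_nonneg _) (div_le_one_of_le₀ ?_ (by positivity))
        exact_mod_cast hA.le
      · exact ((E j A).le_opNorm v).trans
          (mul_le_mul_of_nonneg_right (hE j A hA.le) (norm_nonneg _))
  have h2 := (V.continuous.tendsto _).comp hmain
  have h3 : V ((1 + ∑' j, E j (N j)) v) = v := by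
    have := congrArg (fun T : X →L[𝕜] X => T v) hV
    simpa using this
  rw [h3] at h2
  refine h2.congr fun n => ?_
  simp [map_sum]

end Frames

/-! ### Disjointly supported functions in `L_p` -/

section Disjoint

variable {α 𝕜 : Type*} [MeasurableSpace α] {μ : Measure α} [RCLike 𝕜] {p q : ℝ≥0∞}

lemma eLpNorm_rpow_toReal (hp₀ : p ≠ 0) (hp : p ≠ ∞) (u : α → 𝕜) :
    eLpNorm u p μ ^ p.toReal = ∫⁻ x, ‖u x‖ₑ ^ p.toReal ∂μ := by
  have : 0 < p.toReal := ENNReal.toReal_pos hp₀ hp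
  rw [eLpNorm_eq_lintegral_rpow_enorm_toReal hp₀ hp, ← ENNReal.rpow_mul,
    one_div_mul_cancel this.ne', ENNReal.rpow_one]

lemma eLpNorm_sum_rpow_of_disjoint_support (hp₀ : p ≠ 0) (hp : p ≠ ∞) {ι : Type*} (s : Finset ι)
    {u : ι → α → 𝕜} (hu : ∀ i ∈ s, AEStronglyMeasurable (u i) μ)
    (hd : (s : Set ι).PairwiseDisjoint fun i => Function.support (u i)) :
    eLpNorm (fun x => ∑ i ∈ s, u i x) p μ ^ p.toReal =
      ∑ i ∈ s, eLpNorm (u i) p μ ^ p.toReal := by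
  have hr : 0 < p.toReal := ENNReal.toReal_pos hp₀ hp
  simp only [eLpNorm_rpow_toReal hp₀ hp]
  rw [← lintegral_finsetSum' s fun i hi => (hu i hi).enorm.pow_const _]
  refine lintegral_congr fun x => ?_
  by_cases h : ∃ i ∈ s, u i x ≠ 0
  · obtain ⟨i, hi, hx⟩ := h
    have h0 : ∀ j ∈ s, j ≠ i → u j x = 0 := fun j hj hji => by
      by_contra hne
      exact Set.disjoint_left.1 (hd hj hi hji) hne hx
    rw [Finset.sum_eq_single_of_mem i hi h0, Finset.sum_eq_single_of_mem i hi]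
    intro j hj hji
    simp [h0 j hj hji, hr]
  · push Not at h
    rw [Finset.sum_eq_zero h, Finset.sum_eq_zero]
    · simp [hr]
    · intro i hi
      simp [h i hi, hr]

lemma Lp_coeFn_sum {ι : Type*} (s : Finset ι) (f : ι → Lp 𝕜 p μ) :
    ⇑(∑ i ∈ s, f i) =ᵐ[μ] fun x => ∑ i ∈ s, f i x := by
  classical
  induction s using Finset.induction_on with
  | empty => simpa only [Finset.sum_empty] using! Lp.coeFn_zero 𝕜 p μ
  | insert i s hi ih =>
    rw [Finset.sum_insert hi]
    filter_upwards [Lp.coeFn_add (f i) (∑ i ∈ s, f i), ih] with x h1 h2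
    rw [h1, Pi.add_apply, h2, Finset.sum_insert hi]

lemma indicatorConstLp_eq_sum {ι : Type*} {Q : ι → Set α} (hQ : ∀ i, MeasurableSet (Q i))
    (hμ : ∀ i, μ (Q i) ≠ ∞)
    (hd : Pairwise fun i j => Disjoint (Q i) (Q j)) {s : Finset ι} {A : Set α}
    (hA : MeasurableSet A) (hμA : μ A ≠ ∞) (h : A = ⋃ i ∈ s, Q i) :
    indicatorConstLp q hA hμA (1 : 𝕜) = ∑ i ∈ s, indicatorConstLp q (hQ i) (hμ i) (1 : 𝕜) := by
  refine Lp.ext ?_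
  have h1 : ∀ᵐ x ∂μ, ∀ i ∈ s, indicatorConstLp q (hQ i) (hμ i) (1 : 𝕜) x =
      (Q i).indicator (fun _ => 1) x :=
    (ae_ball_iff s.countable_toSet).2 fun i _ => indicatorConstLp_coeFn
  filter_upwards [h1, Lp_coeFn_sum s fun i => indicatorConstLp q (hQ i) (hμ i) (1 : 𝕜),
    indicatorConstLp_coeFn (p := q) (hs := hA) (hμs := hμA) (c := (1 : 𝕜))] with x h1 h2 h3
  rw [h2, h3, Finset.sum_congr rfl h1, h,
    Finset.indicator_biUnion_apply s Q fun i _ j _ hij => hd hij]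

end Disjoint

/-! ### Averaging operators -/

section Averaging

variable {α 𝕜 : Type*} [MeasurableSpace α] {μ : Measure α} [RCLike 𝕜] {p q : ℝ≥0∞}
  [Fact (1 ≤ p)] [Fact (1 ≤ q)] [p.HolderConjugate q]

variable (𝕜 p q) in
/-- The functional `h ↦ ∫ x in Q, h x` on `L_q`, as the pairing with the indicator of `Q` in
`L_p`. -/
noncomputable def indicatorFunctional {Q : Set α} (hQ : MeasurableSet Q) (hμ : μ Q ≠ ∞) :
    StrongDual 𝕜 (Lp 𝕜 q μ) :=
  (ContinuousLinearMap.mul 𝕜 𝕜).lpPairing μ p q (indicatorConstLp p hQ hμ 1)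

lemma indicatorFunctional_apply {Q : Set α} (hQ : MeasurableSet Q) (hμ : μ Q ≠ ∞)
    (h : Lp 𝕜 q μ) : indicatorFunctional 𝕜 p q hQ hμ h = ∫ x in Q, h x ∂μ := by
  rw [indicatorFunctional, ContinuousLinearMap.lpPairing_eq_integral, ← integral_indicator hQ]
  refine integral_congr_ae ?_
  filter_upwards [indicatorConstLp_coeFn (p := p) (hs := hQ) (hμs := hμ) (c := (1 : 𝕜))]
    with x hx
  by_cases hxQ : x ∈ Q <;> simp [hx, hxQ]

variable (𝕜 p q) in
/-- The rank one operator sending `h` to its mean over `Q` times the indicator of `Q`; it vanishes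
if `Q` is a null set. -/
noncomputable def meanOperator {Q : Set α} (hQ : MeasurableSet Q) (hμ : μ Q ≠ ∞) :
    Lp 𝕜 q μ →L[𝕜] Lp 𝕜 q μ :=
  (indicatorFunctional 𝕜 p q hQ hμ).smulRight
    (((μ.real Q : ℝ) : 𝕜)⁻¹ • indicatorConstLp q hQ hμ 1)

lemma meanOperator_coeFn {Q : Set α} (hQ : MeasurableSet Q) (hμ : μ Q ≠ ∞) (h : Lp 𝕜 q μ) :
    meanOperator 𝕜 p q hQ hμ h =ᵐ[μ]
      Q.indicator fun _ => (∫ x in Q, h x ∂μ) * ((μ.real Q : ℝ) : 𝕜)⁻¹ := by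
  rw [meanOperator, ContinuousLinearMap.smulRight_apply, indicatorFunctional_apply, smul_smul]
  filter_upwards [indicatorConstLp_coeFn (p := q) (hs := hQ) (hμs := hμ) (c := (1 : 𝕜)),
    Lp.coeFn_smul ((∫ x in Q, h x ∂μ) * ((μ.real Q : ℝ) : 𝕜)⁻¹)
      (indicatorConstLp q hQ hμ (1 : 𝕜))] with x h1 h2
  rw [h2, Pi.smul_apply, h1]
  by_cases hx : x ∈ Q <;> simp [hx]

lemma eLpNorm_mean_indicator_le (hq : q ≠ ∞) {Q : Set α} (hQ : MeasurableSet Q) (hμ : μ Q ≠ ∞)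
    (h : Lp 𝕜 q μ) :
    eLpNorm (Q.indicator fun _ => (∫ x in Q, h x ∂μ) * ((μ.real Q : ℝ) : 𝕜)⁻¹) q μ ≤
      eLpNorm (Q.indicator h) q μ := by
  have hq1 : 1 ≤ q := Fact.out
  have hq0 : q ≠ 0 := (one_pos.trans_le hq1).ne'
  have hr : 0 < q.toReal := ENNReal.toReal_pos hq0 hq
  rw [eLpNorm_indicator_const hQ hq0 hq, eLpNorm_indicator_eq_eLpNorm_restrict hQ]
  rcases eq_or_ne (μ Q) 0 with h0 | h0
  · simp [h0, hr]
  have h1 : ‖∫ x in Q, h x ∂μ‖ₑ ≤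
      eLpNorm h q (μ.restrict Q) * μ Q ^ (1 - 1 / q.toReal) := by
    refine (enorm_integral_le_lintegral_enorm _).trans ?_
    rw [← eLpNorm_one_eq_lintegral_enorm]
    simpa using eLpNorm_le_eLpNorm_mul_rpow_measure_univ (μ := μ.restrict Q) hq1
      (Lp.aestronglyMeasurable h).restrict
  have h2 : ‖((μ.real Q : ℝ) : 𝕜)⁻¹‖ₑ = (μ Q)⁻¹ := by
    have hne : ((μ.real Q : ℝ) : 𝕜) ≠ 0 := by
      simp [Measure.real, ENNReal.toReal_eq_zero_iff, h0, hμ]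
    rw [enorm_inv hne, ← ofReal_norm, RCLike.norm_ofReal, abs_of_nonneg measureReal_nonneg,
      Measure.real, ENNReal.ofReal_toReal hμ]
  rw [enorm_mul, h2]
  calc _ ≤ eLpNorm h q (μ.restrict Q) * μ Q ^ (1 - 1 / q.toReal) * (μ Q)⁻¹ *
        μ Q ^ (1 / q.toReal) := by gcongr
    _ = eLpNorm h q (μ.restrict Q) *
        (μ Q ^ (1 - 1 / q.toReal) * μ Q ^ (1 / q.toReal) * (μ Q)⁻¹) := by ring
    _ = _ := by
      rw [← ENNReal.rpow_add _ _ h0 hμ, sub_add_cancel, ENNReal.rpow_one,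
        ENNReal.mul_inv_cancel h0 hμ, mul_one]

variable {ι : Type*} {Q : ι → Set α}

/-- Averaging over disjoint sets is a contraction of `L_q`. -/
lemma norm_sum_meanOperator_le (hq : q ≠ ∞) (hQ : ∀ i, MeasurableSet (Q i)) (hμ : ∀ i, μ (Q i) ≠ ∞)
    (hd : Pairwise fun i j => Disjoint (Q i) (Q j)) (s : Finset ι) :
    ‖∑ i ∈ s, meanOperator 𝕜 p q (hQ i) (hμ i)‖ ≤ 1 := by
  refine ContinuousLinearMap.opNorm_le_bound _ zero_le_one fun h => ?_
  have hq0 : q ≠ 0 := (one_pos.trans_le (Fact.out : 1 ≤ q)).ne'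
  have hr : 0 < q.toReal := ENNReal.toReal_pos hq0 hq
  rw [one_mul, sum_apply, Lp.norm_def, Lp.norm_def]
  refine ENNReal.toReal_mono (Lp.eLpNorm_ne_top h) ?_
  have hae : (∑ i ∈ s, meanOperator 𝕜 p q (hQ i) (hμ i) h : Lp 𝕜 q μ) =ᵐ[μ] fun x =>
      ∑ i ∈ s, (Q i).indicator
        (fun _ => (∫ x in Q i, h x ∂μ) * ((μ.real (Q i) : ℝ) : 𝕜)⁻¹) x := by
    refine (Lp_coeFn_sum s _).trans ?_
    have h1 : ∀ᵐ x ∂μ, ∀ i ∈ s, meanOperator 𝕜 p q (hQ i) (hμ i) h x = (Q i).indicator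
        (fun _ => (∫ x in Q i, h x ∂μ) * ((μ.real (Q i) : ℝ) : 𝕜)⁻¹) x :=
      (ae_ball_iff s.countable_toSet).2 fun i _ => meanOperator_coeFn (hQ i) (hμ i) h
    filter_upwards [h1] with x hx using Finset.sum_congr rfl hx
  have hdis : ∀ v : ι → α → 𝕜, (s : Set ι).PairwiseDisjoint fun i =>
      Function.support ((Q i).indicator (v i)) := fun v i _ j _ hij =>
    (hd hij).mono (by simp) (by simp)
  rw [eLpNorm_congr_ae hae, ← ENNReal.rpow_le_rpow_iff hr,
    eLpNorm_sum_rpow_of_disjoint_support hq0 hq s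
      (fun i _ => (aestronglyMeasurable_const.indicator (hQ i))) (hdis _)]
  calc _ ≤ ∑ i ∈ s, eLpNorm ((Q i).indicator h) q μ ^ q.toReal := by
        gcongr with i hi
        exact eLpNorm_mean_indicator_le hq (hQ i) (hμ i) h
    _ = eLpNorm (fun x => ∑ i ∈ s, (Q i).indicator h x) q μ ^ q.toReal :=
        (eLpNorm_sum_rpow_of_disjoint_support hq0 hq s
          (fun i _ => (Lp.aestronglyMeasurable h).indicator (hQ i)) (hdis _)).symm
    _ ≤ _ := by
        gcongr
        refine eLpNorm_mono fun x => ?_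
        rw [← Finset.indicator_biUnion_apply s Q fun i _ j _ hij => hd hij]
        exact norm_indicator_le_norm_self _ _

lemma sum_meanOperator_indicatorConstLp (hQ : ∀ i, MeasurableSet (Q i)) (hμ : ∀ i, μ (Q i) ≠ ∞)
    (hd : Pairwise fun i j => Disjoint (Q i) (Q j)) {s : Finset ι} {j : ι} (hj : j ∈ s) :
    (∑ i ∈ s, meanOperator 𝕜 p q (hQ i) (hμ i)) (indicatorConstLp q (hQ j) (hμ j) (1 : 𝕜)) =
      indicatorConstLp q (hQ j) (hμ j) 1 := by
  have hint : ∀ i, indicatorFunctional 𝕜 p q (hQ i) (hμ i)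
      (indicatorConstLp q (hQ j) (hμ j) (1 : 𝕜)) = ((μ.real (Q j ∩ Q i) : ℝ) : 𝕜) := fun i => by
    rw [indicatorFunctional_apply, setIntegral_indicatorConstLp (hQ i)]
    simp [RCLike.real_smul_eq_coe_mul]
  rw [sum_apply, Finset.sum_eq_single_of_mem j hj]
  · rw [meanOperator, ContinuousLinearMap.smulRight_apply, hint, Set.inter_self, smul_smul]
    rcases eq_or_ne (μ.real (Q j)) 0 with h0 | h0
    · have : indicatorConstLp q (hQ j) (hμ j) (1 : 𝕜) = 0 := by
        have h1 : μ (Q j) = 0 := (measureReal_eq_zero_iff (hμ j)).1 h0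
        exact Lp.eq_zero_iff_ae_eq_zero.2 (indicatorConstLp_coeFn.trans
          (indicator_meas_zero h1))
      rw [this, smul_zero]
    · rw [mul_inv_cancel₀ (by exact_mod_cast h0), one_smul]
  · intro i _ hij
    rw [meanOperator, ContinuousLinearMap.smulRight_apply, hint,
      (hd hij.symm).inter_eq]
    simp

end Averaging

/-! ### Schauder frames of `L_q` with indicator functionals -/

section IndicatorFrame

lemma tendsto_of_tendsto_on_dense_span {𝕜 X : Type*} [RCLike 𝕜] [NormedAddCommGroup X]
    [NormedSpace 𝕜 X] {P : ℕ → X →L[𝕜] X} (hP : ∀ m, ‖P m‖ ≤ 1) {D : Set X}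
    (hD : ∀ v, v ∈ closure (Submodule.span 𝕜 D : Set X))
    (h : ∀ v ∈ D, Tendsto (fun m => P m v) atTop (𝓝 v)) (v : X) :
    Tendsto (fun m => P m v) atTop (𝓝 v) := by
  have hspan : ∀ w ∈ Submodule.span 𝕜 D, Tendsto (fun m => P m w) atTop (𝓝 w) := by
    intro w hw
    induction hw using Submodule.span_induction with
    | mem w hw => exact h w hw
    | zero => simp
    | add a b _ _ ha hb => simpa using ha.add hb
    | smul c a _ ha => simpa using ha.const_smul c
  rw [Metric.tendsto_atTop]
  intro ε hε
  obtain ⟨w, hw, hvw⟩ := Metric.mem_closure_iff.1 (hD v) (ε / 3) (by positivity)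
  obtain ⟨M, hM⟩ := Metric.tendsto_atTop.1 (hspan w hw) (ε / 3) (by positivity)
  refine ⟨M, fun m hm => ?_⟩
  have h1 : dist (P m v) (P m w) ≤ dist v w := by
    rw [dist_eq_norm, dist_eq_norm, ← map_sub]
    exact ((P m).le_opNorm _).trans (mul_le_of_le_one_left (norm_nonneg _) (hP m))
  have h2 := dist_triangle4 (P m v) (P m w) w v
  have h3 := hM m hm
  rw [dist_comm w v] at h2
  linarith

variable {α : Type*}

/-- The atoms of the partition of `⋃ i < m, A i` generated by `A 0, …, A (m - 1)`: the points
that belong to `A i`, for `i < m`, exactly when `i ∈ s`. The set is empty for `s = ∅`. -/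
def atomSet (A : ℕ → Set α) (m : ℕ) (s : Finset ℕ) : Set α :=
  {x | s.Nonempty ∧ ∀ i, i ∈ s ↔ i < m ∧ x ∈ A i}

lemma measurableSet_atomSet [MeasurableSpace α] {A : ℕ → Set α} (hA : ∀ i, MeasurableSet (A i))
    (m : ℕ) (s : Finset ℕ) : MeasurableSet (atomSet A m s) := by
  have h : atomSet A m s = {_x | s.Nonempty} ∩ ⋂ i, {x | i ∈ s ↔ i < m ∧ x ∈ A i} := by
    ext x
    simp [atomSet]
  rw [h]
  exact (MeasurableSet.const _).inter (MeasurableSet.iInter fun i =>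
    (MeasurableSet.const (i ∈ s)).iff ((MeasurableSet.const (i < m)).inter (hA i)))

lemma disjoint_atomSet (A : ℕ → Set α) (m : ℕ) :
    Pairwise fun s t => Disjoint (atomSet A m s) (atomSet A m t) := fun _ _ hst =>
  Set.disjoint_left.2 fun _ hs ht => hst (Finset.ext fun i => (hs.2 i).trans (ht.2 i).symm)

lemma atomSet_subset {A : ℕ → Set α} {m : ℕ} {s : Finset ℕ} {i : ℕ} (hi : i ∈ s) :
    atomSet A m s ⊆ A i := fun _ hx => ((hx.2 i).1 hi).2

lemma eq_iUnion_atomSet (A : ℕ → Set α) {m n : ℕ} (hn : n < m) :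
    A n = ⋃ s ∈ (Finset.range m).powerset.filter (n ∈ ·), atomSet A m s := by
  classical
  refine subset_antisymm (fun x hx => ?_) (Set.iUnion₂_subset fun s hs =>
    atomSet_subset (Finset.mem_filter.1 hs).2)
  have hmem : n ∈ (Finset.range m).filter (x ∈ A ·) := by simp [hn, hx]
  refine Set.mem_iUnion₂.2 ⟨(Finset.range m).filter (x ∈ A ·), ?_, ⟨n, hmem⟩, ?_⟩
  · rw [Finset.mem_filter]
    exact ⟨Finset.mem_powerset.2 (Finset.filter_subset _ _), hmem⟩
  · simp

variable {𝕜 : Type*} [MeasurableSpace α] {μ : Measure α} [RCLike 𝕜] {p q : ℝ≥0∞}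

/-- `L_q` has a Schauder frame whose functionals integrate over sets from a given hereditary family
of sets of finite measure with total indicators. The finite rank operators behind it average over
the atoms generated by a countable dense part of the family, and so fix more and more of its
indicators. -/
theorem exists_isSchauderFrame_indicatorFunctional [Fact (1 ≤ p)] [Fact (1 ≤ q)]
    [p.HolderConjugate q] [SecondCountableTopology (Lp 𝕜 q μ)] (hq : q ≠ ∞) {𝒮 : Set (Set α)}
    (hempty : ∅ ∈ 𝒮) (hmeas : ∀ Q ∈ 𝒮, MeasurableSet Q) (hfin : ∀ Q ∈ 𝒮, μ Q ≠ ∞)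
    (hsub : ∀ Q ∈ 𝒮, ∀ Q' ⊆ Q, MeasurableSet Q' → Q' ∈ 𝒮)
    (hdense : ∀ v : Lp 𝕜 q μ, v ∈ closure (Submodule.span 𝕜
      (Set.range fun Q : 𝒮 => indicatorConstLp q (hmeas Q Q.2) (hfin Q Q.2) (1 : 𝕜)) : Set _)) :
    ∃ (x : ℕ → Lp 𝕜 q μ) (Q : ℕ → 𝒮), IsSchauderFrame x fun n =>
      indicatorFunctional 𝕜 p q (hmeas _ (Q n).2) (hfin _ (Q n).2) := by
  set ind : 𝒮 → Lp 𝕜 q μ :=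
    fun Q => indicatorConstLp q (hmeas Q Q.2) (hfin Q Q.2) (1 : 𝕜) with hind
  have : Nonempty (Set.range ind) := ⟨⟨_, ⟨⟨∅, hempty⟩, rfl⟩⟩⟩
  choose A hA using fun n => (TopologicalSpace.denseSeq (Set.range ind) n).2
  have hD : ∀ v, v ∈ closure (Submodule.span 𝕜 (Set.range fun n => ind (A n)) : Set (Lp 𝕜 q μ)) := by
    have h1 : Set.range ind ⊆ closure (Set.range fun n => ind (A n)) := by
      rintro _ ⟨Q, rfl⟩
      have h2 := TopologicalSpace.denseRange_denseSeq (Set.range ind) ⟨ind Q, Q, rfl⟩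
      have h3 := image_closure_subset_closure_image continuous_subtype_val ⟨_, h2, rfl⟩
      rw [← Set.range_comp] at h3
      simpa only [hA, Function.comp_def] using h3
    have h4 : Submodule.span 𝕜 (Set.range ind) ≤
        (Submodule.span 𝕜 (Set.range fun n => ind (A n))).topologicalClosure :=
      Submodule.span_le.2 (h1.trans (closure_mono Submodule.subset_span))
    intro v
    exact closure_minimal h4 (Submodule.isClosed_topologicalClosure _) (hdense v)
  let B : ℕ → Set α := fun n => A n
  have hat : ∀ m s, atomSet B m s ∈ 𝒮 := by
    intro m s
    rcases s.eq_empty_or_nonempty with rfl | ⟨i, hi⟩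
    · simpa [atomSet] using hempty
    · exact hsub _ (A i).2 _ (atomSet_subset hi)
        (measurableSet_atomSet (fun i => hmeas _ (A i).2) m s)
  let P : ℕ → Lp 𝕜 q μ →L[𝕜] Lp 𝕜 q μ := fun m => ∑ s ∈ (Finset.range m).powerset,
    meanOperator 𝕜 p q (hmeas _ (hat m s)) (hfin _ (hat m s))
  have hlim : ∀ v, Tendsto (fun m => P m v) atTop (𝓝 v) := by
    refine tendsto_of_tendsto_on_dense_span
      (fun m => norm_sum_meanOperator_le hq _ _ (disjoint_atomSet B m) _) hD ?_
    rintro _ ⟨n, rfl⟩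
    refine tendsto_const_nhds.congr' ?_
    filter_upwards [eventually_gt_atTop n] with m hm
    have h1 : ind (A n) = ∑ s ∈ (Finset.range m).powerset.filter (n ∈ ·),
        indicatorConstLp q (hmeas _ (hat m s)) (hfin _ (hat m s)) (1 : 𝕜) :=
      indicatorConstLp_eq_sum _ _ (disjoint_atomSet B m) _ _ (eq_iUnion_atomSet B hm)
    rw [h1, map_sum]
    refine Finset.sum_congr rfl fun s hs => ?_
    exact (sum_meanOperator_indicatorConstLp _ _ (disjoint_atomSet B m)
      (Finset.mem_filter.1 hs).1).symm
  obtain ⟨x, φ, hφ, hfr⟩ := exists_isSchauderFrame_of_finiteRank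
    (Φ := Set.range fun Q : 𝒮 => indicatorFunctional 𝕜 p q (hmeas _ Q.2) (hfin _ Q.2))
    ⟨_, ⟨⟨∅, hempty⟩, rfl⟩⟩ (P := P)
    (fun m => Submodule.sum_mem _ fun s _ => Submodule.subset_span
      ⟨_, ⟨⟨_, hat m s⟩, rfl⟩, _, rfl⟩) hlim
  choose Q hQ using hφ
  refine ⟨x, Q, ?_⟩
  simpa only [hQ] using hfr

/-- Indicators of bounded measurable sets of small diameter are total in `L_q` of a separable metric
space: a set of finite measure is exhausted by finite disjoint unions of such sets. -/
lemma mem_closure_span_indicator_ball [PseudoMetricSpace α] [SecondCountableTopology α]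
    [OpensMeasurableSpace α] [Fact (1 ≤ q)] (hq : q ≠ ∞) {r : ℝ} (hr : 0 < r) {𝒮 : Set (Set α)}
    (h𝒮 : 𝒮 = {Q | MeasurableSet Q ∧ ∃ z, Q ⊆ Metric.ball z r})
    (hmeas : ∀ Q ∈ 𝒮, MeasurableSet Q) (hfin : ∀ Q ∈ 𝒮, μ Q ≠ ∞) (v : Lp 𝕜 q μ) :
    v ∈ closure (Submodule.span 𝕜
      (Set.range fun Q : 𝒮 => indicatorConstLp q (hmeas Q Q.2) (hfin Q Q.2) (1 : 𝕜)) : Set _) := by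
  set W := Submodule.span 𝕜
      (Set.range fun Q : 𝒮 => indicatorConstLp q (hmeas Q Q.2) (hfin Q Q.2) (1 : 𝕜)) with hW
  refine Lp.induction hq (motive := fun v => v ∈ closure (W : Set (Lp 𝕜 q μ))) ?_ ?_
    isClosed_closure v
  · intro c s hs hμs
    rw [Lp.simpleFunc.coe_indicatorConst]
    rcases isEmpty_or_nonempty α with hα | hα
    · have : indicatorConstLp q hs hμs.ne c = (0 : Lp 𝕜 q μ) :=
        Lp.ext (ae_of_all _ fun x => hα.elim x)
      rw [this]
      exact subset_closure W.zero_mem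
    let S : ℕ → Set α := disjointed fun n => Metric.ball (TopologicalSpace.denseSeq α n) r
    have hSm : ∀ n, MeasurableSet (S n) := MeasurableSet.disjointed fun _ => measurableSet_ball
    have hSd : Pairwise fun i j => Disjoint (s ∩ S i) (s ∩ S j) := fun i j hij =>
      (disjoint_disjointed _ hij).mono Set.inter_subset_right Set.inter_subset_right
    have hcov : ⋃ n, S n = Set.univ := by
      rw [iUnion_disjointed, Set.eq_univ_iff_forall]
      intro x
      obtain ⟨n, hn⟩ := (TopologicalSpace.denseRange_denseSeq α).exists_dist_lt x hr
      exact Set.mem_iUnion.2 ⟨n, hn⟩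
    have hmem : ∀ n, s ∩ S n ∈ 𝒮 := fun n => by
      rw [h𝒮]
      exact ⟨hs.inter (hSm n), _, Set.inter_subset_right.trans (disjointed_subset _ n)⟩
    let U : ℕ → Set α := fun n => ⋃ i ∈ Finset.range n, s ∩ S i
    have hUm : ∀ n, MeasurableSet (U n) := fun n =>
      Finset.measurableSet_biUnion _ fun i _ => hmeas _ (hmem i)
    have hUs : ∀ n, U n ⊆ s := fun n => Set.iUnion₂_subset fun _ _ => Set.inter_subset_left
    have hUfin : ∀ n, μ (U n) ≠ ∞ := fun n => ((measure_mono (hUs n)).trans_lt hμs).ne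
    have hlim : Tendsto (fun n => indicatorConstLp q (hUm n) (hUfin n) (1 : 𝕜)) atTop
        (𝓝 (indicatorConstLp q hs hμs.ne 1)) := by
      refine tendsto_indicatorConstLp_set hq ?_
      have hanti : Antitone fun n => s \ U n := fun m n hmn =>
        Set.sdiff_subset_sdiff_right (Set.biUnion_subset_biUnion_left fun i hi =>
          Finset.range_mono hmn hi)
      have h1 := tendsto_measure_iInter_atTop (μ := μ)
        (fun n => (hs.diff (hUm n)).nullMeasurableSet) hanti
        ⟨0, ((measure_mono Set.sdiff_subset).trans_lt hμs).ne⟩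
      have h2 : ⋂ n, s \ U n = ∅ := by
        rw [← Set.sdiff_iUnion, Set.sdiff_eq_empty]
        intro x hx
        obtain ⟨n, hn⟩ := Set.mem_iUnion.1 (hcov ▸ Set.mem_univ x : x ∈ ⋃ n, S n)
        exact Set.mem_iUnion.2 ⟨n + 1, Set.mem_iUnion₂.2 ⟨n, by simp, hx, hn⟩⟩
      rw [h2, measure_empty] at h1
      refine h1.congr fun n => ?_
      rw [Function.comp_apply, Set.symmDiff_def, Set.sdiff_eq_empty.2 (hUs n), Set.empty_union]
    have hc : indicatorConstLp q hs hμs.ne c =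
        c • (indicatorConstLp q hs hμs.ne 1 : Lp 𝕜 q μ) := by
      refine Lp.ext ?_
      filter_upwards [indicatorConstLp_coeFn (p := q) (hs := hs) (hμs := hμs.ne) (c := c),
        indicatorConstLp_coeFn (p := q) (hs := hs) (hμs := hμs.ne) (c := (1 : 𝕜)),
        Lp.coeFn_smul c (indicatorConstLp q hs hμs.ne (1 : 𝕜))] with x h1 h2 h3
      rw [h1, h3, Pi.smul_apply, h2]
      by_cases hx : x ∈ s <;> simp [hx]
    rw [hc]
    refine (Submodule.topologicalClosure W).smul_mem c
      (mem_closure_of_tendsto hlim (Eventually.of_forall fun n => ?_))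
    rw [indicatorConstLp_eq_sum (fun i => hmeas _ (hmem i)) (fun i => hfin _ (hmem i)) hSd
      (hUm n) (hUfin n) rfl]
    exact W.sum_mem fun i _ => Submodule.subset_span ⟨⟨_, hmem i⟩, rfl⟩
  · intro f g hf hg _ h1 h2
    exact (Submodule.topologicalClosure W).add_mem h1 h2

end IndicatorFrame

/-! ### Sparse sequences of translations -/

section Separation

variable {V : Type*} [NormedAddCommGroup V]

/-- `‖μ m‖` is large compared with the points `z 0, …, z m` and with the earlier `μ i`. The factors
`2` and `3` count the other vectors in a difference `(z l - μ l + μ k) - (z l' - μ l' + μ k')` from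
which `μ m` is to be isolated. The first condition is needed separately only for `m = 0`. -/
structure IsSparse (z μ : ℕ → V) : Prop where
  add_le_norm (m : ℕ) : 1 + 2 * ∑ i ∈ Finset.range (m + 1), ‖z i‖ ≤ ‖μ m‖
  add_three_mul_le_norm (m i : ℕ) :
    i < m → 1 + 2 * ∑ j ∈ Finset.range (m + 1), ‖z j‖ + 3 * ‖μ i‖ ≤ ‖μ m‖

lemma exists_isSparse_subsequence {lam : ℕ → V} (hlam : ¬ Bornology.IsBounded (Set.range lam))
    (z : ℕ → V) : ∃ k : ℕ → ℕ, StrictMono k ∧ IsSparse z fun n => lam (k n) := by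
  have hunb : ∀ (C : ℝ) (n : ℕ), ∃ k, n < k ∧ C ≤ ‖lam k‖ := by
    intro C n
    by_contra! hcon
    refine hlam (isBounded_iff_forall_norm_le.2
      ⟨max C (∑ i ∈ Finset.range (n + 1), ‖lam i‖), ?_⟩)
    rintro _ ⟨k, rfl⟩
    rcases le_or_gt k n with h | h
    · exact le_max_of_le_right (Finset.single_le_sum (f := fun i => ‖lam i‖)
        (fun _ _ => norm_nonneg _) (Finset.mem_range.2 (Nat.lt_succ_of_le h)))
    · exact le_max_of_le_left (hcon k h).le
  choose F hF₁ hF₂ using hunb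
  let B : ℕ → ℝ := fun m => ∑ i ∈ Finset.range (m + 1), ‖z i‖
  have hB : ∀ m, 0 ≤ B m := fun m => Finset.sum_nonneg fun _ _ => norm_nonneg _
  let k : ℕ → ℕ := fun n => Nat.rec (F (1 + 2 * B 0) 0)
    (fun n kn => F (1 + 2 * B (n + 1) + 3 * ‖lam kn‖) kn) n
  have hstep : ∀ n, 1 + 2 * B (n + 1) + 3 * ‖lam (k n)‖ ≤ ‖lam (k (n + 1))‖ := fun n => hF₂ _ _
  have hmono : Monotone fun n => ‖lam (k n)‖ := monotone_nat_of_le_succ fun n => by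
    linarith [hstep n, hB (n + 1), norm_nonneg (lam (k n))]
  refine ⟨k, strictMono_nat_of_lt_succ fun n => hF₁ _ _, fun m => ?_, fun m i hi => ?_⟩
  · cases m with
    | zero => exact hF₂ _ _
    | succ m => exact (le_add_of_nonneg_right (by positivity)).trans (hstep m)
  · cases m with
    | zero => omega
    | succ m =>
      have h1 := hmono (Nat.lt_succ_iff.1 hi)
      have h2 := hstep m
      simp only [B] at h1 h2
      linarith

lemma one_le_norm_of_eq_add {u e y y' a b c : V} {B M : ℝ}
    (h : u = e + (y - y') + (a + b + c)) (hy : ‖y‖ ≤ B) (hy' : ‖y'‖ ≤ B) (ha : ‖a‖ ≤ M)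
    (hb : ‖b‖ ≤ M) (hc : ‖c‖ ≤ M) (hu : 1 + 2 * B + 3 * M ≤ ‖u‖) : 1 ≤ ‖e‖ := by
  have h1 : ‖u‖ ≤ ‖e‖ + ‖y - y'‖ + ‖a + b + c‖ := h ▸ norm_add₃_le
  have h2 := norm_sub_le y y'
  have h3 := norm_add₃_le (a := a) (b := b) (c := c)
  linarith

lemma norm_le_norm_add_self [NormedSpace ℝ V] (v : V) : ‖v‖ ≤ ‖v + v‖ := by
  rw [← two_smul ℝ, norm_smul, Real.norm_ofNat]
  linarith [norm_nonneg v]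

namespace IsSparse

variable {z μ : ℕ → V}

lemma exists_bounds (h : IsSparse z μ) (m : ℕ) : ∃ B M : ℝ, 0 ≤ B ∧ 0 ≤ M ∧ (∀ i ≤ m, ‖z i‖ ≤ B) ∧
    (∀ i < m, ‖μ i‖ ≤ M) ∧ 1 + 2 * B + 3 * M ≤ ‖μ m‖ := by
  -- `M` is the largest value allowed by the last conjunct.
  refine ⟨∑ i ∈ Finset.range (m + 1), ‖z i‖,
    (‖μ m‖ - (1 + 2 * ∑ i ∈ Finset.range (m + 1), ‖z i‖)) / 3,
    Finset.sum_nonneg fun _ _ => norm_nonneg _, ?_, fun i hi => ?_, fun i hi => ?_, ?_⟩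
  · linarith [h.add_le_norm m]
  · exact Finset.single_le_sum (f := fun i => ‖z i‖) (fun _ _ => norm_nonneg _)
      (Finset.mem_range.2 (Nat.lt_succ_of_le hi))
  · linarith [h.add_three_mul_le_norm m i hi]
  · linarith

lemma one_le_dist (h : IsSparse z μ) {l l' : ℕ} (hl : l ≠ l') :
    1 ≤ dist (z l - μ l) (z l' - μ l') := by
  wlog hlt : l' < l generalizing l l'
  · rw [dist_comm]
    exact this hl.symm (by omega)
  obtain ⟨B, M, -, hM, hz, hμ, hm⟩ := h.exists_bounds l
  rw [dist_eq_norm]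
  refine one_le_norm_of_eq_add (u := -μ l) (y := z l') (y' := z l) (a := -μ l') (b := 0) (c := 0)
    (by abel) (hz _ hlt.le) (hz _ le_rfl) (by simpa using hμ _ hlt) (by simpa) (by simpa)
    (by simpa)

/-- Two translates of the points `z l - μ l` by different `μ k`, `μ k'` stay apart. The largest
index among the four enters the difference with coefficient `±1` or `±2`, unless it is `l = l'`;
the diagonal `l = k` is excluded since there `μ` drops out. -/
lemma one_le_dist_translate [NormedSpace ℝ V] (h : IsSparse z μ) {k k' l l' : ℕ} (hk : k ≠ k')
    (hl : l ≠ k) (hl' : l' ≠ k') : 1 ≤ dist (z l - μ l + μ k) (z l' - μ l' + μ k') := by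
  wlog hmax : max k' l' ≤ max k l generalizing k k' l l'
  · rw [dist_comm]
    exact this hk.symm hl' hl (by omega)
  rw [dist_eq_norm]
  rcases lt_or_gt_of_ne hl with hlk | hlk
  · rw [max_eq_left hlk.le, max_le_iff] at hmax
    have hk'k : k' < k := lt_of_le_of_ne hmax.1 hk.symm
    obtain ⟨B, M, hB, hM, hz, hμ, hm⟩ := h.exists_bounds k
    rcases hmax.2.eq_or_lt with rfl | hl'k
    · exact one_le_norm_of_eq_add (u := μ l' + μ l') (y := z l') (y' := z l) (a := μ l) (b := μ k')
        (c := 0) (by abel) (hz _ le_rfl) (hz _ hlk.le) (hμ _ hlk) (hμ _ hk'k) (by simpa)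
        (hm.trans (norm_le_norm_add_self _))
    · exact one_le_norm_of_eq_add (u := μ k) (y := z l') (y' := z l) (a := μ l) (b := -μ l')
        (c := μ k') (by abel) (hz _ hl'k.le) (hz _ hlk.le) (hμ _ hlk)
        (by simpa using hμ _ hl'k) (hμ _ hk'k) hm
  · rw [max_eq_right hlk.le, max_le_iff] at hmax
    rcases hmax.2.eq_or_lt with rfl | hl'l
    · rcases lt_or_gt_of_ne hk with hkk | hkk
      · obtain ⟨B, M, hB, hM, hz, hμ, hm⟩ := h.exists_bounds k'
        exact one_le_norm_of_eq_add (u := -μ k') (B := B) (y := 0) (y' := 0) (a := -μ k) (b := 0)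
          (c := 0) (by abel) (by simpa) (by simpa) (by simpa using hμ _ hkk) (by simpa) (by simpa)
          (by simpa)
      · obtain ⟨B, M, hB, hM, hz, hμ, hm⟩ := h.exists_bounds k
        exact one_le_norm_of_eq_add (u := μ k) (B := B) (y := 0) (y' := 0) (a := μ k') (b := 0)
          (c := 0) (by abel) (by simpa) (by simpa) (hμ _ hkk) (by simpa) (by simpa) hm
    · obtain ⟨B, M, hB, hM, hz, hμ, hm⟩ := h.exists_bounds l
      rcases hmax.1.eq_or_lt with rfl | hk'l
      · exact one_le_norm_of_eq_add (u := -(μ k' + μ k')) (y := z l') (y' := z k') (a := -μ k)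
          (b := -μ l') (c := 0) (by abel) (hz _ hl'l.le) (hz _ le_rfl) (by simpa using hμ _ hlk)
          (by simpa using hμ _ hl'l) (by simpa)
          (by rw [norm_neg]; exact hm.trans (norm_le_norm_add_self _))
      · exact one_le_norm_of_eq_add (u := -μ l) (y := z l') (y' := z l) (a := -μ k) (b := -μ l')
          (c := μ k') (by abel) (hz _ hl'l.le) (hz _ le_rfl) (by simpa using hμ _ hlk)
          (by simpa using hμ _ hl'l) (hμ _ hk'l) (by simpa)

end IsSparse

end Separation

/-! ### The function whose translates form the frame -/

section Translates

variable {𝕜 : Type*} [RCLike 𝕜] {d : ℕ} {p q : ℝ≥0∞}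

lemma translateLp_toLp_coeFn {f : EuclideanSpace ℝ (Fin d) → 𝕜} (hf : MemLp f p volume)
    (a : EuclideanSpace ℝ (Fin d)) :
    translateLp a (hf.toLp f) =ᵐ[volume] fun x => f (x - a) := by
  have h := measurePreserving_sub_right (volume : Measure (EuclideanSpace ℝ (Fin d))) a
  exact (Lp.coeFn_compMeasurePreserving _ h).trans (h.quasiMeasurePreserving.ae_eq_comp
    hf.coeFn_toLp)

lemma norm_dualFunctional_le [Fact (1 ≤ p)] [Fact (1 ≤ q)] [p.HolderConjugate q]
    (f : Lp 𝕜 p (volume : Measure (EuclideanSpace ℝ (Fin d)))) :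
    ‖dualFunctional (q := q) f‖ ≤ ‖f‖ := by
  refine ContinuousLinearMap.opNorm_le_bound _ (norm_nonneg _) fun h => ?_
  have h1 : dualFunctional (q := q) f h =
      L1.integral ((ContinuousLinearMap.mul 𝕜 𝕜).holder 1 f h) := by
    rw [dualFunctional, ContinuousLinearMap.lpPairing_eq_integral, L1.integral_eq_integral]
    exact (integral_congr_ae (ContinuousLinearMap.coeFn_holder _ f h)).symm
  rw [h1]
  refine (L1.norm_integral_le _).trans
    ((ContinuousLinearMap.norm_holder_apply_apply_le _ f h).trans ?_)
  gcongr
  exact mul_le_of_le_one_left (norm_nonneg _) (ContinuousLinearMap.opNorm_mul_le 𝕜 𝕜)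

/-- Let `f = ∑ n, c n • 1_{Q n - μ n}`. After translation by `μ n` the `n`-th summand becomes
`c n • 1_{Q n}`, while the remainders for different `n` are disjointly supported and no larger than
`f`. So the norm of a sum of `A` remainders only grows like `A ^ (1 / p)`. -/
theorem exists_translates_close (hp₀ : p ≠ 0) (hp : p ≠ ∞)
    {Q : ℕ → Set (EuclideanSpace ℝ (Fin d))} (hQ : ∀ n, MeasurableSet (Q n))
    (hQfin : ∀ n, volume (Q n) ≠ ∞) {z μ : ℕ → EuclideanSpace ℝ (Fin d)}
    (hz : ∀ n, Q n ⊆ Metric.ball (z n) (1 / 2)) (hsp : IsSparse z μ) {c : ℕ → 𝕜}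
    (hc : ∑' n, ‖c n‖ₑ ^ p.toReal * volume (Q n) ≤ 1) :
    ∃ F : Lp 𝕜 p (volume : Measure (EuclideanSpace ℝ (Fin d))), ∀ o A : ℕ,
      ‖∑ a ∈ Finset.range A, (translateLp (μ (o + a)) F -
        c (o + a) • indicatorConstLp p (hQ (o + a)) (hQfin (o + a)) (1 : 𝕜))‖ ≤
      (A : ℝ) ^ (1 / p.toReal) := by
  have hr : 0 < p.toReal := ENNReal.toReal_pos hp₀ hp
  -- The set `Q n - μ n`.
  let P : ℕ → Set (EuclideanSpace ℝ (Fin d)) := fun n => (· + μ n) ⁻¹' Q n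
  have hPm : ∀ n, MeasurableSet (P n) := fun n => measurable_add_const _ (hQ n)
  have hPz : ∀ n, P n ⊆ Metric.ball (z n - μ n) (1 / 2) := fun n x hx => by
    have h1 := hz n hx
    rw [Metric.mem_ball, dist_eq_norm] at h1 ⊢
    rwa [sub_sub_eq_add_sub]
  have hPd : ∀ {n m x}, x ∈ P n → x ∈ P m → m = n := fun {n m x} hn hm => by
    by_contra hne
    exact Set.disjoint_left.1 (Metric.ball_disjoint_ball
      (by linarith [hsp.one_le_dist hne])) (hPz m hm) (hPz n hn)
  let f : EuclideanSpace ℝ (Fin d) → 𝕜 := fun x => ∑' n, (P n).indicator (fun _ => c n) x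
  have hfsum : ∀ n x, x ∈ P n → HasSum (fun n => (P n).indicator (fun _ => c n) x) (c n) := by
    intro n x hx
    have h1 := hasSum_single (f := fun n => (P n).indicator (fun _ => c n) x) n
      fun m hm => Set.indicator_of_notMem (fun hxm => hm (hPd hx hxm)) _
    simpa [hx] using h1
  have hf0 : ∀ x, (∀ n, x ∉ P n) → HasSum (fun n => (P n).indicator (fun _ => c n) x) 0 := by
    intro x hx
    simp [hx]
  have hfx : ∀ x, HasSum (fun n => (P n).indicator (fun _ => c n) x) (f x) := by
    intro x
    by_cases h : ∃ n, x ∈ P n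
    · exact (hfsum _ x h.choose_spec).summable.hasSum
    · exact (hf0 x (not_exists.1 h)).summable.hasSum
  have hfP : ∀ n x, x ∈ P n → f x = c n := fun n x hx => (hfx x).unique (hfsum n x hx)
  have hfm : Measurable f :=
    measurable_of_tendsto_metrizable (f := fun N x => ∑ n ∈ Finset.range N,
      (P n).indicator (fun _ => c n) x)
      (fun N => Finset.measurable_fun_sum _ fun n _ => measurable_const.indicator (hPm n))
      (tendsto_pi_nhds.2 fun x => (hfx x).tendsto_sum_nat)
  have hfnorm : eLpNorm f p volume ^ p.toReal ≤ 1 := by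
    rw [eLpNorm_rpow_toReal hp₀ hp]
    refine le_trans ?_ hc
    have h1 : ∀ n, ‖c n‖ₑ ^ p.toReal * volume (Q n) =
        ∫⁻ x, (P n).indicator (fun _ => ‖c n‖ₑ ^ p.toReal) x := fun n => by
      rw [lintegral_indicator_const (hPm n), measure_preimage_add_right]
    simp only [h1]
    rw [← lintegral_tsum fun n => (measurable_const.indicator (hPm n)).aemeasurable]
    refine lintegral_mono fun x => ?_
    by_cases h : ∃ n, x ∈ P n
    · obtain ⟨n, hn⟩ := h
      refine le_trans (le_of_eq ?_) (ENNReal.le_tsum n)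
      rw [hfP n x hn, Set.indicator_of_mem hn]
    · rw [(hfx x).unique (hf0 x (not_exists.1 h))]
      simp [hr]
  have hfle : eLpNorm f p volume ≤ 1 := by
    rw [← ENNReal.rpow_le_rpow_iff hr]
    simpa using hfnorm
  have hfLp : MemLp f p volume :=
    ⟨hfm.aestronglyMeasurable, hfle.trans_lt ENNReal.one_lt_top⟩
  refine ⟨hfLp.toLp f, fun o A => ?_⟩
  -- The remainder `T_{μ n} f - c n • 1_{Q n}`, which vanishes on `Q n`.
  let G : ℕ → EuclideanSpace ℝ (Fin d) → 𝕜 := fun n x =>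
    f (x - μ n) - (Q n).indicator (fun _ => c n) x
  have hPQ : ∀ n x, x - μ n ∈ P n ↔ x ∈ Q n := fun n x => by simp [P]
  have hGQ : ∀ n x, x ∈ Q n → G n x = 0 := fun n x hx => by
    simp [G, hx, hfP n _ ((hPQ n x).2 hx)]
  have hGle : ∀ n x, ‖G n x‖ ≤ ‖f (x - μ n)‖ := fun n x => by
    by_cases hx : x ∈ Q n
    · simp [hGQ n x hx]
    · simp [G, hx]
  have hGsupp : ∀ n x, G n x ≠ 0 →
      ∃ l, l ≠ n ∧ x ∈ Metric.ball (z l - μ l + μ n) (1 / 2) := by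
    intro n x hx
    have h1 : f (x - μ n) ≠ 0 := fun h0 => hx (norm_le_zero_iff.1 (by simpa [h0] using hGle n x))
    have h2 : ∃ l, x - μ n ∈ P l := by
      by_contra h
      exact h1 ((hfx _).unique (hf0 _ (not_exists.1 h)))
    obtain ⟨l, hl⟩ := h2
    refine ⟨l, ?_, ?_⟩
    · rintro rfl
      exact hx (hGQ _ _ ((hPQ _ _).1 hl))
    · have h3 := hPz l hl
      rw [Metric.mem_ball, dist_eq_norm] at h3 ⊢
      rwa [show x - (z l - μ l + μ n) = x - μ n - (z l - μ l) by abel]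
  have hGd : ∀ n m, n ≠ m → Disjoint (Function.support (G n)) (Function.support (G m)) := by
    intro n m hnm
    refine Set.disjoint_left.2 fun x hn hm => ?_
    obtain ⟨l, hl, hxl⟩ := hGsupp n x hn
    obtain ⟨l', hl', hxl'⟩ := hGsupp m x hm
    exact Set.disjoint_left.1 (Metric.ball_disjoint_ball
      (by linarith [hsp.one_le_dist_translate hnm hl hl'])) hxl hxl'
  have hGm : ∀ n, AEStronglyMeasurable (G n) volume := fun n =>
    ((hfm.comp (measurable_sub_const _)).sub
      (measurable_const.indicator (hQ n))).aestronglyMeasurable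
  have hGnorm : ∀ n, eLpNorm (G n) p volume ≤ 1 := fun n => by
    refine (eLpNorm_mono (hGle n)).trans ?_
    have h1 := eLpNorm_comp_measurePreserving (p := p) hfm.aestronglyMeasurable
      (measurePreserving_sub_right volume (μ n))
    exact h1.trans_le hfle
  have hterm : ∀ n, (translateLp (μ n) (hfLp.toLp f) -
      c n • indicatorConstLp p (hQ n) (hQfin n) (1 : 𝕜) : Lp 𝕜 p volume) =ᵐ[volume] G n := by
    intro n
    filter_upwards [translateLp_toLp_coeFn hfLp (μ n), Lp.coeFn_sub (translateLp (μ n) (hfLp.toLp f))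
      (c n • indicatorConstLp p (hQ n) (hQfin n) (1 : 𝕜)),
      Lp.coeFn_smul (c n) (indicatorConstLp p (hQ n) (hQfin n) (1 : 𝕜)),
      indicatorConstLp_coeFn (p := p) (hs := hQ n) (hμs := hQfin n) (c := (1 : 𝕜))]
      with x h1 h2 h3 h4
    rw [h2, Pi.sub_apply, h1, h3, Pi.smul_apply, h4]
    by_cases hx : x ∈ Q n <;> simp [G, hx]
  have hae : (∑ a ∈ Finset.range A, (translateLp (μ (o + a)) (hfLp.toLp f) -
      c (o + a) • indicatorConstLp p (hQ (o + a)) (hQfin (o + a)) (1 : 𝕜)) : Lp 𝕜 p volume)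
      =ᵐ[volume] fun x => ∑ a ∈ Finset.range A, G (o + a) x := by
    refine (Lp_coeFn_sum _ _).trans ?_
    filter_upwards [ae_all_iff.2 hterm] with x hx using Finset.sum_congr rfl fun a _ => hx _
  rw [Lp.norm_def, eLpNorm_congr_ae hae]
  refine ENNReal.toReal_le_of_le_ofReal (by positivity) ?_
  rw [← ENNReal.ofReal_rpow_of_nonneg (by positivity) (by positivity), ENNReal.ofReal_natCast,
    ← ENNReal.rpow_le_rpow_iff hr, ← ENNReal.rpow_mul, one_div_mul_cancel hr.ne', ENNReal.rpow_one,
    eLpNorm_sum_rpow_of_disjoint_support hp₀ hp _ (fun a _ => hGm (o + a))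
      (fun a _ b _ hab => hGd _ _ (by simpa using hab))]
  calc _ ≤ ∑ a ∈ Finset.range A, (1 : ℝ≥0∞) := by
        gcongr with a
        exact ENNReal.rpow_le_one (hGnorm _) hr.le
    _ = A := by simp

end Translates

/-! ### Choice of the multiplicities -/

section Multiplicity

/-- For `r > 2` a large block length `N` makes both the error `N ^ (1 / r)` negligible against
`N ^ (1 / 2)` and the sum `N * N ^ (-r / 2)` of the `r`-th powers of the coefficients small. -/
lemma exists_multiplicity {r : ℝ} (hr : 2 < r) (C : ℝ) (D : ℝ≥0∞) (hD : D ≠ ∞) {ε : ℝ}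
    (hε : 0 < ε) : ∃ N : ℕ, 0 < N ∧ (N : ℝ) ^ (1 / r) * C ≤ (N : ℝ) ^ (1 / 2 : ℝ) * ε ∧
      N * (ENNReal.ofReal ((N : ℝ) ^ (-(1 / 2) : ℝ)) ^ r * D) ≤ ENNReal.ofReal ε := by
  have h1 : Tendsto (fun N : ℕ => (N : ℝ) ^ (-(1 / 2 - 1 / r)) * C) atTop (𝓝 (0 * C)) := by
    refine ((tendsto_rpow_neg_atTop ?_).comp tendsto_natCast_atTop_atTop).mul_const C
    have : 1 / r < 1 / 2 := one_div_lt_one_div_of_lt two_pos hr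
    linarith
  have h2 : Tendsto (fun N : ℕ => (N : ℝ) ^ (-(r / 2 - 1)) * D.toReal) atTop
      (𝓝 (0 * D.toReal)) := by
    refine ((tendsto_rpow_neg_atTop ?_).comp tendsto_natCast_atTop_atTop).mul_const _
    linarith
  rw [zero_mul] at h1 h2
  obtain ⟨N, hN, hN1, hN2⟩ := ((eventually_gt_atTop 0).and
    ((h1.eventually_le_const hε).and (h2.eventually_le_const hε))).exists
  have hN0 : (0 : ℝ) < N := by exact_mod_cast hN
  refine ⟨N, hN, ?_, ?_⟩
  · have h3 : (N : ℝ) ^ (1 / r) = (N : ℝ) ^ (1 / 2 : ℝ) * (N : ℝ) ^ (-(1 / 2 - 1 / r)) := by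
      rw [← Real.rpow_add hN0]
      ring_nf
    rw [h3, mul_assoc]
    gcongr
  · have h3 : (N : ℝ) ^ (-(r / 2 - 1)) = N * ((N : ℝ) ^ (-(1 / 2) : ℝ)) ^ r := by
      rw [← Real.rpow_mul hN0.le, ← Real.rpow_one_add' hN0.le (by linarith)]
      ring_nf
    rw [ENNReal.ofReal_rpow_of_nonneg (by positivity) (by linarith), ← ENNReal.ofReal_toReal hD,
      ← ENNReal.ofReal_natCast, ← ENNReal.ofReal_mul (by positivity),
      ← ENNReal.ofReal_mul (by positivity), ← mul_assoc, ← h3]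
    exact ENNReal.ofReal_le_ofReal hN2

lemma tsum_le_tsum_of_blocks {L : ℕ → ℕ} (hL : ∀ j, 0 < L j) {w b : ℕ → ℝ≥0∞}
    (h : ∀ j, ∑ a ∈ Finset.range (L j), w (∑ i ∈ Finset.range j, L i + a) ≤ b j) :
    ∑' n, w n ≤ ∑' j, b j := by
  rw [ENNReal.tsum_eq_iSup_nat]
  refine iSup_le fun n => ?_
  calc ∑ i ∈ Finset.range n, w i
      ≤ ∑ i ∈ Finset.range (∑ i ∈ Finset.range n, L i), w i :=
        Finset.sum_le_sum_of_subset (Finset.range_mono ((strictMono_sum_range hL).le_apply))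
    _ ≤ ∑ j ∈ Finset.range n, b j := by
        rw [sum_range_sum_range]
        exact Finset.sum_le_sum fun j _ => h j
    _ ≤ _ := ENNReal.sum_le_tsum _

end Multiplicity

/-! ### Frames of translates -/

theorem mainTheorem5 {𝕜 : Type*} [RCLike 𝕜] (d : ℕ) (p q : ℝ≥0∞) [Fact (1 ≤ p)] [Fact (1 ≤ q)]
    [p.HolderConjugate q] (hq₁ : 1 < q) (hq₂ : q < 2)
    (lam : ℕ → EuclideanSpace ℝ (Fin d)) (hlam : ¬ Bornology.IsBounded (Set.range lam)) :
    ∃ (f : Lp 𝕜 p (volume : Measure (EuclideanSpace ℝ (Fin d))))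
      (g : ℕ → Lp 𝕜 q (volume : Measure (EuclideanSpace ℝ (Fin d)))),
      IsSchauderFrame (𝕜 := 𝕜) g (fun n => dualFunctional (translateLp (lam n) f)) := by
  have hqt : q ≠ ∞ := (hq₂.trans (by simp)).ne
  have hpt : p ≠ ∞ := by
    exact ((ENNReal.HolderConjugate.lt_top_iff_one_lt p q).2 hq₁).ne
  have hp0 : p ≠ 0 := (one_pos.trans_le (Fact.out : 1 ≤ p)).ne'
  have hpq : p.toReal.HolderConjugate q.toReal := ENNReal.HolderConjugate.toReal_of_ne_top hpt hqt
  have hr2 : 2 < p.toReal := by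
    have h1 : q.toReal < 2 := by
      simpa using (ENNReal.toReal_lt_toReal hqt (by simp)).2 hq₂
    nlinarith [hpq.mul_eq_add, hpq.symm.lt, hpq.lt]
  have : Fact (q ≠ ∞) := ⟨hqt⟩
  let 𝒮 : Set (Set (EuclideanSpace ℝ (Fin d))) :=
    {Q | MeasurableSet Q ∧ ∃ z, Q ⊆ Metric.ball z (1 / 2)}
  have hfin : ∀ Q ∈ 𝒮, volume Q ≠ ∞ := fun Q hQ =>
    ((measure_mono hQ.2.choose_spec).trans_lt measure_ball_lt_top).ne
  obtain ⟨x, Q, hx⟩ := exists_isSchauderFrame_indicatorFunctional (𝕜 := 𝕜) (p := p) (q := q)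
    (μ := volume) (𝒮 := 𝒮) hqt ⟨.empty, 0, Set.empty_subset _⟩ (fun Q hQ => hQ.1) hfin
    (fun Q hQ Q' hQ' hm => ⟨hm, hQ.2.imp fun z hz => hQ'.trans hz⟩)
    (mem_closure_span_indicator_ball hqt one_half_pos rfl (fun Q hQ => hQ.1) hfin)
  choose z hz using fun j => (Q j).2.2
  choose N hN0 hN1 hN2 using fun j : ℕ => exists_multiplicity hr2 ‖x j‖ (volume (Q j : Set _))
    (hfin _ (Q j).2) (ε := 1 / 4 * (1 / 2) ^ j) (by positivity)
  -- `J n` is the number of the block containing `n`.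
  obtain ⟨J, hJ⟩ := exists_concat hN0 fun j _ => j
  -- The coefficient `N ^ (-1 / 2)` is small enough for `f ∈ L_p`, as `1 / p < 1 / 2`, and large enough
  -- for the errors to be negligible, as `1 / 2 < 1 / q`.
  let c : ℕ → 𝕜 := fun j => (((N j : ℝ) ^ (-(1 / 2) : ℝ) : ℝ) : 𝕜)
  have hcn : ∀ j, ‖c j‖ = (N j : ℝ) ^ (-(1 / 2) : ℝ) := fun j => by
    rw [RCLike.norm_ofReal, abs_of_nonneg (by positivity)]
  obtain ⟨k, hk, hsp⟩ := exists_isSparse_subsequence hlam fun n => z (J n)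
  obtain ⟨F, hF⟩ := exists_translates_close (𝕜 := 𝕜) hp0 hpt (Q := fun n => Q (J n))
    (fun n => (Q (J n)).2.1) (fun n => hfin _ (Q (J n)).2) (fun n => hz (J n)) hsp
    (c := fun n => c (J n)) (by
      refine (tsum_le_tsum_of_blocks hN0
        (b := fun j => ENNReal.ofReal (1 / 4 * (1 / 2) ^ j)) fun j => ?_).trans ?_
      · refine le_trans (le_of_eq ?_) (hN2 j)
        rw [Finset.sum_congr rfl fun a ha => by rw [hJ j a (Finset.mem_range.1 ha)],
          Finset.sum_const, Finset.card_range, nsmul_eq_mul, ← ofReal_norm, hcn]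
      · rw [← ENNReal.ofReal_tsum_of_nonneg (fun _ => by positivity)
          (summable_geometric_two.mul_left _), tsum_mul_left, tsum_geometric_two]
        norm_num)
  obtain ⟨g, hg⟩ := hx.exists_of_block_perturbation hN0 (c := c)
    (fun j => norm_pos_iff.1 (by
      rw [hcn]
      have : (0 : ℝ) < N j := by exact_mod_cast hN0 j
      positivity))
    (ψ := fun n => dualFunctional (translateLp (lam (k n)) F)) (by
      intro j A hA
      have hNj : (0 : ℝ) < N j := by exact_mod_cast hN0 j
      have h1 : ∑ a ∈ Finset.range A, (dualFunctional (q := q)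
            (translateLp (lam (k (∑ i ∈ Finset.range j, N i + a))) F) -
          c j • indicatorFunctional 𝕜 p q (Q j).2.1 (hfin _ (Q j).2)) =
          dualFunctional (∑ a ∈ Finset.range A,
            (translateLp (lam (k (∑ i ∈ Finset.range j, N i + a))) F -
              c j • indicatorConstLp p (Q j).2.1 (hfin _ (Q j).2) (1 : 𝕜))) := by
        simp only [dualFunctional, indicatorFunctional, map_sum, map_sub, map_smul]
      have h2 : ‖∑ a ∈ Finset.range A,
            (translateLp (lam (k (∑ i ∈ Finset.range j, N i + a))) F -
              c j • indicatorConstLp p (Q j).2.1 (hfin _ (Q j).2) (1 : 𝕜))‖ ≤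
          (A : ℝ) ^ (1 / p.toReal) := by
        refine le_trans (le_of_eq ?_) (hF (∑ i ∈ Finset.range j, N i) A)
        congr 1
        refine Finset.sum_congr rfl fun a ha => ?_
        have := hJ j a ((Finset.mem_range.1 ha).trans_le hA)
        congr! 1
        simp only [this]
      have h3 : (N j : ℝ) * ‖c j‖ = (N j : ℝ) ^ (1 / 2 : ℝ) := by
        rw [hcn, ← Real.rpow_one_add' hNj.le (by norm_num)]
        norm_num
      rw [h1, h3]
      refine le_trans ?_ (hN1 j)
      gcongr
      refine (norm_dualFunctional_le _).trans (h2.trans ?_)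
      gcongr)
  exact ⟨F, hg.of_subsequence hk⟩
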